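/- Fix an integer $d\ge 2$. A $d$-ary tree is a finite rooted tree in which every internal vertex has at least two and at most $d$ children; the empty tree is also allowed. Let $\|T\|$ be the number of leaves of $T$ (so $\|T\|=0$ for the empty tree, and $\|T\|=1$ for the tree with a single vertex). A set $S$ of leaves of $T$ induces a $d$-ary tree: take the smallest subtree of $T$ containing $S$ and suppress all vertices with only one child. For $d$-ary trees $D,T$ let $c(D,T)$ be the number of sets of $\|D\|$ leaves of $T$ that induce a tree isomorphic to $D$ (as a rooted tree), let $\gamma(D,T)=c(D,T)/\binom{\|T\|}{\|D\|}$, and let the $d$-ary inducibility of $D$ be $$I_d(D)=\limsup_{\|T\|\to\infty,\ T\ d\text{-ary tree}}\gamma(D,T)$$ (in particular $I_d(D)=1$ if $D$ is empty). Let $D$ be a $d$-ary tree with at least two leaves, with branches $D_1,\dots,D_d$ (the components that remain when the root is removed, some of the $D_i$ possibly empty). Call two permutations $\pi,\pi'$ of $\{1,\dots,d\}$ equivalent if $D_{\pi(j)}$ is isomorphic to $D_{\pi'(j)}$ for every $j$, let $M(D)$ be a complete set of representatives of the equivalence classes, and define $$Z_D(x_1,\dots,x_d)=\frac{1}{1-\sum_{i=1}^d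 x_i^{\|D\|}}\sum_{\pi\in M(D)}\prod_{j=1}^d x_j^{\|D_{\pi(j)}\|}.$$ Then the supremum below is finite, and $$I_d(D)\le \binom{\|D\|}{\|D_1\|,\|D_2\|,\dots,\|D_d\|}\Big(\prod_{i=1}^d I_d(D_i)\Big)\sup_{\substack{0\le x_1,\dots,x_d<1\\ x_1+\cdots+x_d=1}} Z_D(x_1,\dots,x_d).$$ -/

import Mathlib

/-- Finite rooted trees in which every internal vertex has at most `d` children, together with the
empty tree. The branches at an internal vertex are listed as a family indexed by `Fin d`, padded
with empty trees if there are fewer than `d` children; `leaf` is the tree with a single vertex.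
The order of the branches and the positions of the padding are forgotten by `DTree.Iso`. -/
inductive DTree (d : ℕ) : Type where
  | empty : DTree d
  | leaf : DTree d
  | node (branch : Fin d → DTree d) : DTree d

namespace DTree

variable {d : ℕ}

/-- `T` is a (possibly empty) `d`-ary tree: every internal vertex has at least two (and, by the
shape of the type, at most `d`) children. -/
def IsDary : DTree d → Prop
  | empty => True
  | leaf => True
  | node B => (∃ i j, i ≠ j ∧ B i ≠ empty ∧ B j ≠ empty) ∧ ∀ i, (B i).IsDary

/-- The size `‖T‖` of a tree: its number of leaves. -/
def numLeaves : DTree d → ℕ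
  | empty => 0
  | leaf => 1
  | node B => ∑ i, (B i).numLeaves

/-- The type of leaves of a tree. -/
inductive Leaf : DTree d → Type where
  | here : Leaf leaf
  | child {B : Fin d → DTree d} (i : Fin d) (l : Leaf (B i)) : Leaf (node B)

/-- Isomorphism of rooted trees: the branches correspond to each other, up to isomorphism, under
some permutation. -/
inductive Iso : DTree d → DTree d → Prop where
  | empty : Iso empty empty
  | leaf : Iso leaf leaf
  | node {B C : Fin d → DTree d} (σ : Equiv.Perm (Fin d)) (h : ∀ i, Iso (B i) (C (σ i))) :
      Iso (node B) (node C)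

theorem Iso.refl (T : DTree d) : Iso T T := by
  induction T with
  | empty => exact Iso.empty
  | leaf => exact Iso.leaf
  | node B ih => exact Iso.node (Equiv.refl _) ih

theorem Iso.symm {S T : DTree d} (h : Iso S T) : Iso T S := by
  induction h with
  | empty => exact Iso.empty
  | leaf => exact Iso.leaf
  | @node B C σ _ ih =>
    refine Iso.node σ.symm fun i => ?_
    simpa using ih (σ.symm i)

theorem Iso.trans {S T U : DTree d} (h : Iso S T) (h' : Iso T U) : Iso S U := by
  induction h generalizing U with
  | empty => exact h'
  | leaf => exact h'
  | @node B C σ _ ih =>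
    cases h' with
    | node τ k => exact Iso.node (σ.trans τ) fun i => ih i (k (σ i))

open Classical in
/-- The tree obtained by attaching the trees `B i` to a new root and suppressing this root if it
has only one child (if all the `B i` are empty, the result is empty). -/
noncomputable def join (B : Fin d → DTree d) : DTree d :=
  if ∃ i j, i ≠ j ∧ B i ≠ empty ∧ B j ≠ empty then node B
  else if h : ∃ i, B i ≠ empty then B h.choose
  else empty

open Classical in
/-- The subtree of `T` induced by a set `S` of leaves: the leaves outside `S` are removed, together
with all vertices that are then without leaves below them, and every vertex with only one remaining
child is suppressed. -/
noncomputable def induced : (T : DTree d) → Set (Leaf T) → DTree d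
  | empty, _ => empty
  | leaf, S => if Leaf.here ∈ S then leaf else empty
  | node B, S => join fun i => (B i).induced {l | Leaf.child i l ∈ S}

/-- `c(D, T)`: the number of sets of `‖D‖` leaves of `T` that induce a tree isomorphic to `D`. -/
noncomputable def copies (D T : DTree d) : ℕ :=
  Set.ncard {S : Set (Leaf T) | S.ncard = D.numLeaves ∧ Iso (T.induced S) D}

/-- The density `γ(D, T)`. -/
noncomputable def density (D T : DTree d) : ℝ :=
  (copies D T : ℝ) / (T.numLeaves.choose D.numLeaves : ℝ)

/-- The `d`-ary inducibility `I_d(D)`: the limit superior of `γ(D, T)` over all `d`-ary trees `T`,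
as `‖T‖ → ∞`. -/
noncomputable def inducibility (D : DTree d) : ℝ :=
  Filter.limsup (fun T : {T : DTree d // T.IsDary} => density D T.1)
    (Filter.comap (fun T : {T : DTree d // T.IsDary} => T.1.numLeaves) Filter.atTop)

/-- The equivalence relation `∼_D` on permutations, where `D` has the branches `B i`. -/
def permSetoid (B : Fin d → DTree d) : Setoid (Equiv.Perm (Fin d)) where
  r π π' := ∀ j, Iso (B (π j)) (B (π' j))
  iseqv :=
    { refl := fun _ _ => Iso.refl _
      symm := fun h j => (h j).symm
      trans := fun h h' j => (h j).trans (h' j) }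

open Classical in
/-- `M(D)`: a complete set of representatives of the equivalence classes of `∼_D`, where `D` has
the branches `B i`. -/
noncomputable def permReps (B : Fin d → DTree d) : Finset (Equiv.Perm (Fin d)) :=
  Finset.univ.image (Quotient.out : Quotient (permSetoid B) → Equiv.Perm (Fin d))

/-- The function `Z_D` for the tree `D` with the branches `B i`. -/
noncomputable def Z (B : Fin d → DTree d) (x : Fin d → ℝ) : ℝ :=
  1 / (1 - ∑ i, x i ^ (node B).numLeaves) *
    ∑ π ∈ permReps B, ∏ j, x j ^ (B (π j)).numLeaves

end DTree

/-- The points of the standard simplex all of whose coordinates are less than `1`. -/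
def truncatedSimplex (d : ℕ) : Set (Fin d → ℝ) :=
  {x | (∀ i, 0 ≤ x i ∧ x i < 1) ∧ ∑ i, x i = 1}

/-!
Let `k = ‖D‖` and write `c(D, T)` for `copies D T`. Let `A` be the supremum of `Z` times the product
of the numbers `I(D_i) / ‖D_i‖!`, where the `D_i` are the branches of `D`. The bound for the
inducibility follows from `c(D, T) ≤ A * ‖T‖ ^ k` for all `T` (`copies_node_le_pow`), because
`‖T‖.choose k` is asymptotically `‖T‖ ^ k / k!`, so that `I(D) ≤ A * k!`.

The proof is by induction on `T`. A copy of `D` in `T` lies in one branch of `T`, or its branches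
are distributed over the branches `T_j` according to a permutation (`copies_node_le`):
`c(D, T) ≤ ∑ j, c(D, T_j) + ∑ π ∈ M(D), ∏ j, c(D_{π j}, T_j)`. With `x_j = ‖T_j‖ / ‖T‖`, the first
sum is at most `A * ‖T‖ ^ k * ∑ j, x_j ^ k` by induction, and the second one at most
`A * ‖T‖ ^ k * (1 - ∑ j, x_j ^ k)` by the definition of the supremum. The induction closes without
an error term, because `c(E, T) ≤ I(E) / ‖E‖! * ‖T‖ ^ ‖E‖` holds exactly for all `E` and `T`
(`copies_le_inducibility`): replacing every leaf of `T` with a tree `U` yields a tree with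
`‖T‖ * ‖U‖` leaves and at least `c(E, T) * ‖U‖ ^ ‖E‖` copies of `E`
(`copies_mul_pow_le_copies_subst`), and `‖U‖` may be as large as desired.

The function `Z` is bounded, since `D` has two nonempty branches: every product in the numerator is
at most `x_a * x_b` for two distinct indices, hence at most `∑ i, x_i * (1 - x_i)`, which is at most
the denominator `1 - ∑ i, x_i ^ k` (`prod_pow_le_one_sub_sum_pow`).
-/

namespace DTree

variable {d : ℕ}

/-! ### Leaves -/

/-- The leaves of `node B` are the leaves of its branches. -/
def leafNodeEquiv (B : Fin d → DTree d) : Leaf (node B) ≃ Σ i, Leaf (B i) where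
  toFun | .child i l => ⟨i, l⟩
  invFun p := .child p.1 p.2
  left_inv := by rintro (_ | ⟨i, l⟩); rfl
  right_inv _ := rfl

instance finite_leaf (T : DTree d) : Finite (Leaf T) := by
  induction T with
  | empty => exact @Finite.of_subsingleton _ ⟨fun a => nomatch a⟩
  | leaf => exact @Finite.of_subsingleton _ ⟨fun | .here, .here => rfl⟩
  | node B ih => exact Finite.of_equiv _ (leafNodeEquiv B).symm

theorem card_leaf (T : DTree d) : Nat.card (Leaf T) = T.numLeaves := by
  induction T with
  | empty => exact @Nat.card_of_isEmpty _ ⟨fun a => nomatch a⟩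
  | leaf => exact Nat.card_eq_one_iff_unique.2 ⟨⟨fun | .here, .here => rfl⟩, ⟨.here⟩⟩
  | node B ih =>
    rw [Nat.card_congr (leafNodeEquiv B), Nat.card_sigma]
    exact Finset.sum_congr rfl fun i _ => ih i

theorem ncard_set_leaf_node {B : Fin d → DTree d} (S : Set (Leaf (node B))) :
    S.ncard = ∑ i, {l | Leaf.child i l ∈ S}.ncard := by
  have e : S ≃ Σ i, {l | Leaf.child i l ∈ S} :=
    { toFun := fun | ⟨.child i l, h⟩ => ⟨i, l, h⟩
      invFun := fun p => ⟨.child p.1 p.2.1, p.2.2⟩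
      left_inv := by rintro ⟨_ | ⟨i, l⟩, h⟩; rfl
      right_inv := fun _ => rfl }
  rw [← Nat.card_coe_set_eq, Nat.card_congr e, Nat.card_sigma]
  simp only [Nat.card_coe_set_eq]

theorem Iso.numLeaves_eq {S T : DTree d} (h : Iso S T) : S.numLeaves = T.numLeaves := by
  induction h with
  | empty => rfl
  | leaf => rfl
  | @node B C σ _ ih =>
    simp only [numLeaves, ih]
    exact Equiv.sum_comp σ fun i => (C i).numLeaves

theorem IsDary.numLeaves_pos {T : DTree d} (hT : T.IsDary) (hne : T ≠ empty) :
    0 < T.numLeaves := by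
  induction T with
  | empty => exact absurd rfl hne
  | leaf => exact Nat.one_pos
  | node B ih =>
    obtain ⟨⟨i, -, -, hi, -⟩, hB⟩ := hT
    exact (ih i (hB i) hi).trans_le
      (Finset.single_le_sum (f := fun i => (B i).numLeaves) (fun _ _ => Nat.zero_le _)
        (Finset.mem_univ i))

/-- A tree with a root of degree at least two has two distinct branches with leaves. -/
theorem IsDary.exists_pos_pos {B : Fin d → DTree d} (h : (node B).IsDary) :
    ∃ i j, i ≠ j ∧ 0 < (B i).numLeaves ∧ 0 < (B j).numLeaves :=
  let ⟨⟨i, j, hij, hi, hj⟩, hB⟩ := h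
  ⟨i, j, hij, (hB i).numLeaves_pos hi, (hB j).numLeaves_pos hj⟩

theorem IsDary.two_le_numLeaves {B : Fin d → DTree d} (h : (node B).IsDary) :
    2 ≤ (node B).numLeaves := by
  obtain ⟨i, j, hij, hi, hj⟩ := h.exists_pos_pos
  have := Finset.add_le_sum (f := fun i => (B i).numLeaves) (fun _ _ => Nat.zero_le _)
    (Finset.mem_univ i) (Finset.mem_univ j) hij
  simp only [numLeaves] at this ⊢
  omega

/-! ### Induced subtrees -/

theorem join_eq_of_forall_ne {B : Fin d → DTree d} (i : Fin d) (h : ∀ j, j ≠ i → B j = empty) :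
    join B = B i := by
  have h2 : ¬ ∃ i j, i ≠ j ∧ B i ≠ empty ∧ B j ≠ empty := by
    rintro ⟨a, b, hab, ha, hb⟩
    exact hab ((not_imp_comm.1 (h a) ha).trans (not_imp_comm.1 (h b) hb).symm)
  rw [join, if_neg h2]
  split_ifs with h1
  · rw [not_imp_comm.1 (h _) h1.choose_spec]
  · push Not at h1
    exact (h1 i).symm

theorem join_eq_empty {B : Fin d → DTree d} (h : ∀ i, B i = empty) : join B = empty := by
  rw [join, if_neg (by rintro ⟨i, -, -, hi, -⟩; exact hi (h i)),
    dif_neg (by rintro ⟨i, hi⟩; exact hi (h i))]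

/-- The three possibilities for `join B`: the root is kept, there is only one branch, or there is
none. -/
theorem join_cases (B : Fin d → DTree d) :
    join B = node B ∨ (∃ i, (∀ j, j ≠ i → B j = empty) ∧ join B = B i) ∨
      (∀ i, B i = empty) ∧ join B = empty := by
  by_cases h2 : ∃ i j, i ≠ j ∧ B i ≠ empty ∧ B j ≠ empty
  · exact Or.inl (if_pos h2)
  by_cases h1 : ∃ i, B i ≠ empty
  · obtain ⟨i, hi⟩ := h1
    have h : ∀ j, j ≠ i → B j = empty := fun j hj => by
      by_contra hne
      exact h2 ⟨j, i, hj, hne, hi⟩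
    exact Or.inr (Or.inl ⟨i, h, join_eq_of_forall_ne i h⟩)
  · push Not at h1
    exact Or.inr (Or.inr ⟨h1, join_eq_empty h1⟩)

theorem numLeaves_join (B : Fin d → DTree d) : (join B).numLeaves = ∑ i, (B i).numLeaves := by
  rcases join_cases B with h | ⟨i, hi, h⟩ | ⟨h0, h⟩
  · rw [h, numLeaves]
  · rw [h, Finset.sum_eq_single i (fun j _ hj => by rw [hi j hj, numLeaves]) (by simp)]
  · simp [h, h0, numLeaves]

theorem numLeaves_induced (T : DTree d) (S : Set (Leaf T)) :
    (T.induced S).numLeaves = S.ncard := by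
  induction T with
  | empty => simp [induced, numLeaves, show S = ∅ from Set.eq_empty_of_forall_notMem nofun]
  | leaf =>
    rw [induced]
    split_ifs with h
    · rw [show S = {Leaf.here} from Set.ext fun | .here => by simpa using h]
      simp [numLeaves]
    · rw [show S = ∅ from Set.eq_empty_of_forall_notMem fun | .here => h]
      simp [numLeaves]
  | node B ih =>
    rw [induced, numLeaves_join, ncard_set_leaf_node]
    exact Finset.sum_congr rfl fun i _ => ih i _

theorem induced_empty (T : DTree d) : T.induced ∅ = empty := by
  induction T with
  | empty => rfl
  | leaf => simp [induced]
  | node B ih =>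
    rw [induced]
    exact join_eq_empty ih

theorem induced_singleton (T : DTree d) (l : Leaf T) : T.induced {l} = leaf := by
  induction l with
  | here => simp [induced]
  | @child B i l ih =>
    rw [induced, join_eq_of_forall_ne i]
    · simpa using ih
    · intro j hj
      rw [← induced_empty (B j)]
      congr 1
      refine Set.eq_empty_of_forall_notMem fun m hm => hj ?_
      cases hm
      rfl

theorem eq_empty_of_induced_eq_empty {T : DTree d} {S : Set (Leaf T)} (h : T.induced S = empty) :
    S = ∅ := by
  have := numLeaves_induced T S
  rw [h, numLeaves] at this
  exact (Set.ncard_eq_zero S.toFinite).1 this.symm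

/-! ### Copies in a tree and in its branches -/

theorem copies_eq (D T : DTree d) :
    copies D T = {S : Set (Leaf T) | Iso (T.induced S) D}.ncard := by
  have h : ∀ S : Set (Leaf T), S.ncard = D.numLeaves ∧ Iso (T.induced S) D ↔
      Iso (T.induced S) D :=
    fun S => and_iff_right_of_imp fun hS => by rw [← hS.numLeaves_eq, numLeaves_induced]
  simp only [copies, h]

theorem copies_le_choose (D T : DTree d) : copies D T ≤ T.numLeaves.choose D.numLeaves := by
  classical
  have := Fintype.ofFinite (Leaf T)
  rw [← card_leaf T, Nat.card_eq_fintype_card, ← Finset.card_univ, ← Finset.card_powersetCard,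
    ← Set.ncard_coe_finset]
  refine (Set.ncard_le_ncard ?_ (Set.toFinite _)).trans
    (Set.ncard_image_le (f := fun s : Finset (Leaf T) => (s : Set (Leaf T))) (Set.toFinite _))
  rintro S ⟨hS, -⟩
  exact ⟨S.toFinset, Finset.mem_powersetCard.2 ⟨Finset.subset_univ _,
    (Set.ncard_eq_toFinset_card' S).symm.trans hS⟩, by simp⟩

/-- Every permutation is equivalent to a representative. -/
theorem exists_mem_permReps (B : Fin d → DTree d) (σ : Equiv.Perm (Fin d)) :
    ∃ π ∈ permReps B, ∀ j, Iso (B (σ j)) (B (π j)) := by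
  classical
  refine ⟨(Quotient.mk (permSetoid B) σ).out, ?_, ?_⟩
  · simp [permReps]
  · exact Setoid.symm' _ (Quotient.mk_out (s := permSetoid B) σ)

/-- A copy of a tree `D` in `T` either lies in a single branch of `T`, or the branches of `D` are
distributed over those of `T` according to a permutation. -/
theorem copies_node_le (B T : Fin d → DTree d) :
    copies (node B) (node T) ≤ ∑ i, copies (node B) (T i) +
      ∑ π ∈ permReps B, ∏ j, copies (B (π j)) (T j) := by
  simp only [copies_eq]
  have hpi : ∀ π : Equiv.Perm (Fin d),
      ∏ j, {S : Set (Leaf (T j)) | Iso ((T j).induced S) (B (π j))}.ncard =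
        (Set.univ.pi fun j => {S : Set (Leaf (T j)) | Iso ((T j).induced S) (B (π j))}).ncard := by
    intro π
    simp only [← Nat.card_coe_set_eq, ← Nat.card_pi]
    exact (Nat.card_congr (Equiv.Set.univPi _)).symm
  simp only [hpi]
  let E : (∀ j, Set (Leaf (T j))) → Set (Leaf (node T)) :=
    fun f => ⋃ j, Leaf.child j '' f j
  have hE : ∀ S : Set (Leaf (node T)), E (fun j => {l | Leaf.child j l ∈ S}) = S := by
    intro S
    ext l
    rcases l with _ | ⟨i, l⟩
    refine Set.mem_iUnion.trans ⟨?_, fun h => ⟨i, l, h, rfl⟩⟩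
    rintro ⟨_, m, hm, hml⟩
    exact hml ▸ hm
  have key : {S : Set (Leaf (node T)) | Iso ((node T).induced S) (node B)} ⊆
      (⋃ i ∈ (Finset.univ : Finset (Fin d)), Set.image (Leaf.child i) ''
        {S : Set (Leaf (T i)) | Iso ((T i).induced S) (node B)}) ∪
      ⋃ π ∈ permReps B, E '' (Set.univ.pi fun j =>
        {S : Set (Leaf (T j)) | Iso ((T j).induced S) (B (π j))}) := by
    intro S hS
    simp only [Set.mem_ofPred_eq, induced] at hS
    rcases join_cases fun i => (T i).induced {l | Leaf.child i l ∈ S} with h | ⟨i, hi, h⟩ | ⟨-, h⟩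
    · rw [h] at hS
      rcases hS with _ | _ | ⟨σ, hσ⟩
      obtain ⟨π, hπ, hσπ⟩ := exists_mem_permReps B σ
      refine Or.inr (Set.mem_biUnion hπ ⟨_, fun j _ => ?_, hE S⟩)
      exact (hσ j).trans (hσπ j)
    · rw [h] at hS
      refine Or.inl (Set.mem_biUnion (Finset.mem_univ i) ⟨_, hS, ?_⟩)
      ext l
      rcases l with _ | ⟨j, l⟩
      constructor
      · rintro ⟨m, hm, hml⟩
        exact hml ▸ hm
      · intro hl
        by_cases hj : j = i
        · subst hj
          exact ⟨l, hl, rfl⟩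
        · exact absurd (eq_empty_of_induced_eq_empty (hi j hj))
            (Set.nonempty_iff_ne_empty.1 ⟨l, hl⟩)
    · rw [h] at hS
      cases hS
  refine (Set.ncard_le_ncard key (Set.toFinite _)).trans ((Set.ncard_union_le _ _).trans ?_)
  refine add_le_add ((Finset.set_ncard_biUnion_le _ _).trans ?_)
    ((Finset.set_ncard_biUnion_le _ _).trans ?_)
  · exact Finset.sum_le_sum fun i _ => Set.ncard_image_le (Set.toFinite _)
  · exact Finset.sum_le_sum fun i _ => Set.ncard_image_le (Set.toFinite _)

/-! ### Substitution of a tree for the leaves -/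

/-- The tree `T[U]` obtained from `T` by replacing every leaf with a copy of `U`. -/
def subst : DTree d → DTree d → DTree d
  | empty, _ => empty
  | leaf, U => U
  | node B, U => node fun i => (B i).subst U

theorem subst_eq_empty_iff {U : DTree d} (hU : U ≠ empty) (T : DTree d) :
    T.subst U = empty ↔ T = empty := by
  cases T <;> simp [subst, hU]

theorem IsDary.subst {U T : DTree d} (hT : T.IsDary) (hU : U.IsDary) (hne : U ≠ empty) :
    (T.subst U).IsDary := by
  induction T with
  | empty => trivial
  | leaf => exact hU
  | node B ih =>
    obtain ⟨⟨i, j, hij, hi, hj⟩, hB⟩ := hT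
    exact ⟨⟨i, j, hij, by rwa [Ne, subst_eq_empty_iff hne], by rwa [Ne, subst_eq_empty_iff hne]⟩,
      fun i => ih i (hB i)⟩

theorem numLeaves_subst (U T : DTree d) :
    (T.subst U).numLeaves = T.numLeaves * U.numLeaves := by
  induction T with
  | empty => simp [subst, numLeaves]
  | leaf => simp [subst, numLeaves]
  | node B ih => simp [subst, numLeaves, ih, Finset.sum_mul]

/-- The leaf of `T[U]` that is the leaf `u` in the copy of `U` replacing the leaf `l` of `T`. -/
def substLeaf {U : DTree d} : {T : DTree d} → Leaf T → Leaf U → Leaf (T.subst U)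
  | _, .here, u => u
  | _, .child i l, u => .child i (substLeaf l u)

theorem substLeaf_inj {U T : DTree d} {l l' : Leaf T} {u u' : Leaf U}
    (h : substLeaf l u = substLeaf l' u') : l = l' ∧ u = u' := by
  induction l with
  | here => cases l'; exact ⟨rfl, h⟩
  | child i l ih =>
    cases l' with
    | child j l' =>
      simp only [substLeaf] at h
      injection h with _ hij hl
      subst hij
      obtain ⟨rfl, rfl⟩ := ih (eq_of_heq hl)
      exact ⟨rfl, rfl⟩

/-- A set of leaves of `T[U]` with exactly one leaf in the copies of `U` at the leaves in `S` and
none in the others induces the same tree as `S`. -/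
theorem induced_subst {U : DTree d} (T : DTree d) (S : Set (Leaf T)) (R : Set (Leaf (T.subst U)))
    (h0 : ∀ l ∉ S, ∀ u, substLeaf l u ∉ R)
    (h1 : ∀ l ∈ S, ∃ v, ∀ u, substLeaf l u ∈ R ↔ u = v) :
    (T.subst U).induced R = T.induced S := by
  induction T with
  | empty => rfl
  | leaf =>
    by_cases h : Leaf.here ∈ S
    · obtain ⟨v, hv⟩ := h1 _ h
      rw [show R = {v} from Set.ext hv, induced, if_pos h]
      exact induced_singleton U v
    · rw [show R = ∅ from Set.eq_empty_of_forall_notMem (h0 _ h), induced, if_neg h]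
      exact induced_empty U
  | node B ih =>
    simp only [subst, induced]
    congr 1
    funext i
    exact ih i _ _ (fun l hl u => h0 (.child i l) hl u) (fun l hl => h1 (.child i l) hl)

theorem copies_mul_pow_le_copies_subst (D T U : DTree d) :
    copies D T * U.numLeaves ^ D.numLeaves ≤ copies D (T.subst U) := by
  have hcard : Nat.card (Σ S : {S : Set (Leaf T) | S.ncard = D.numLeaves ∧ Iso (T.induced S) D},
      (S.1 → Leaf U)) = copies D T * U.numLeaves ^ D.numLeaves := by
    classical
    have := Fintype.ofFinite {S : Set (Leaf T) | S.ncard = D.numLeaves ∧ Iso (T.induced S) D}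
    rw [Nat.card_sigma, Finset.sum_congr rfl (g := fun _ => U.numLeaves ^ D.numLeaves)]
    · rw [Finset.sum_const, smul_eq_mul, Finset.card_univ, ← Nat.card_eq_fintype_card,
        Nat.card_coe_set_eq, copies]
    · rintro ⟨S, hS⟩ -
      rw [Nat.card_fun, card_leaf, Nat.card_coe_set_eq, hS.1]
  rw [← hcard, copies_eq, ← Nat.card_coe_set_eq]
  have hmem : ∀ (S : Set (Leaf T)) (g : S → Leaf U) (l : Leaf T) (u : Leaf U),
      substLeaf l u ∈ Set.range (fun l : S => substLeaf l.1 (g l)) ↔ ∃ h : l ∈ S, u = g ⟨l, h⟩ := by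
    intro S g l u
    constructor
    · rintro ⟨⟨m, hm⟩, h⟩
      obtain ⟨rfl, rfl⟩ := substLeaf_inj h
      exact ⟨hm, rfl⟩
    · rintro ⟨h, rfl⟩
      exact ⟨⟨l, h⟩, rfl⟩
  refine Nat.card_le_card_of_injective
    (fun p => ⟨Set.range fun l : p.1.1 => substLeaf l.1 (p.2 l), ?_⟩) ?_
  · rw [Set.mem_ofPred_eq, induced_subst T p.1.1]
    · exact p.1.2.2
    · intro l hl u h
      exact hl ((hmem _ _ _ _).1 h).1
    · exact fun l hl => ⟨p.2 ⟨l, hl⟩, fun u => (hmem _ _ _ _).trans (exists_prop_of_true hl)⟩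
  · rintro ⟨⟨S, hS⟩, g⟩ ⟨⟨S', hS'⟩, g'⟩ h
    have h' : ∀ l u, (∃ h : l ∈ S, u = g ⟨l, h⟩) ↔ ∃ h : l ∈ S', u = g' ⟨l, h⟩ := by
      intro l u
      rw [← hmem, ← hmem, show Set.range (fun l : S => substLeaf l.1 (g l)) =
        Set.range (fun l : S' => substLeaf l.1 (g' l)) from congrArg Subtype.val h]
    obtain rfl : S = S' := Set.ext fun l =>
      ⟨fun hl => ((h' l _).1 ⟨hl, rfl⟩).1, fun hl => ((h' l _).2 ⟨hl, rfl⟩).1⟩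
    obtain rfl : g = g' := funext fun l => ((h' l _).1 ⟨l.2, rfl⟩).2
    rfl

/-! ### Caterpillars -/

/-- The binary caterpillar with `n + 1` leaves. -/
def caterpillar (d : ℕ) : ℕ → DTree d
  | 0 => leaf
  | n + 1 => node fun i => if i.1 = 0 then leaf else if i.1 = 1 then caterpillar d n else empty

theorem caterpillar_ne_empty (n : ℕ) : caterpillar d n ≠ empty := by
  cases n <;> simp [caterpillar]

theorem isDary_caterpillar (hd : 2 ≤ d) (n : ℕ) : (caterpillar d n).IsDary := by
  induction n with
  | zero => trivial
  | succ n ih =>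
    refine ⟨⟨⟨0, by omega⟩, ⟨1, by omega⟩, by simp, by simp, ?_⟩, fun i => ?_⟩
    · simpa using caterpillar_ne_empty n
    · dsimp only
      split_ifs
      exacts [trivial, ih, trivial]

theorem numLeaves_caterpillar (hd : 2 ≤ d) (n : ℕ) : (caterpillar d n).numLeaves = n + 1 := by
  induction n with
  | zero => rfl
  | succ n ih =>
    obtain ⟨e, rfl⟩ := Nat.exists_eq_add_of_le' hd
    simp [caterpillar, numLeaves, Fin.sum_univ_succ, ih]
    omega


/-! ### Densities and inducibility -/

theorem density_nonneg (D T : DTree d) : 0 ≤ density D T := by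
  unfold density
  positivity

theorem density_le_one (D T : DTree d) : density D T ≤ 1 :=
  div_le_one_of_le₀ (mod_cast copies_le_choose D T) (Nat.cast_nonneg _)

/-- There are arbitrarily large `d`-ary trees. -/
theorem neBot_comap_numLeaves (hd : 2 ≤ d) :
    (Filter.comap (fun T : {T : DTree d // T.IsDary} => T.1.numLeaves) Filter.atTop).NeBot := by
  refine Filter.comap_neBot_iff_frequently.2 (Filter.frequently_atTop.2 fun n => ?_)
  exact ⟨n + 1, n.le_succ, ⟨_, isDary_caterpillar hd n⟩, numLeaves_caterpillar hd n⟩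

theorem le_inducibility {D : DTree d} {a : ℝ}
    (h : ∀ n, ∃ T : DTree d, T.IsDary ∧ n ≤ T.numLeaves ∧ a ≤ density D T) :
    a ≤ inducibility D := by
  refine Filter.le_limsup_of_frequently_le ?_
    ⟨1, Filter.eventually_map.2 (Filter.Eventually.of_forall fun T => density_le_one D T.1)⟩
  refine Filter.frequently_comap.2 (Filter.frequently_atTop.2 fun n => ?_)
  obtain ⟨T, hT, hn, ha⟩ := h n
  exact ⟨_, hn, ⟨T, hT⟩, rfl, ha⟩

/-- Replacing the leaves of `T` by large trees yields arbitrarily large trees in which the density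
of `D` is at least `copies D T * ‖D‖! / ‖T‖ ^ ‖D‖`. -/
theorem copies_mul_factorial_div_le_inducibility (hd : 2 ≤ d) (D : DTree d) {T : DTree d}
    (hT : T.IsDary) (hne : T ≠ empty) :
    (copies D T : ℝ) * (D.numLeaves.factorial : ℝ) / (T.numLeaves : ℝ) ^ D.numLeaves ≤
      inducibility D := by
  have hn : 0 < T.numLeaves := hT.numLeaves_pos hne
  refine le_inducibility fun n => ?_
  set k := D.numLeaves
  -- the caterpillar has at least `n` leaves, and enough for the binomial coefficient below to be
  -- nonzero
  set U := caterpillar d (n + k)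
  have hU : U.numLeaves = n + k + 1 := numLeaves_caterpillar hd _
  have hsize : (T.subst U).numLeaves = T.numLeaves * U.numLeaves := numLeaves_subst U T
  have hle : U.numLeaves ≤ (T.subst U).numLeaves := hsize ▸ Nat.le_mul_of_pos_left _ hn
  refine ⟨T.subst U, hT.subst (isDary_caterpillar hd _) (caterpillar_ne_empty _), by omega, ?_⟩
  have hchoose : 0 < ((T.subst U).numLeaves.choose k : ℝ) :=
    mod_cast Nat.choose_pos (by omega)
  have hcop : (copies D T : ℝ) * (U.numLeaves : ℝ) ^ k ≤ copies D (T.subst U) :=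
    mod_cast copies_mul_pow_le_copies_subst D T U
  have hbound : ((T.subst U).numLeaves.choose k : ℝ) * k.factorial ≤
      (T.numLeaves : ℝ) ^ k * (U.numLeaves : ℝ) ^ k := by
    have := Nat.choose_le_pow_div (α := ℝ) k (T.subst U).numLeaves
    rw [le_div_iff₀ (by positivity)] at this
    rwa [hsize, Nat.cast_mul, mul_pow, ← hsize] at this
  rw [density, div_le_div_iff₀ (by positivity) hchoose]
  calc (copies D T : ℝ) * k.factorial * (T.subst U).numLeaves.choose k
      = copies D T * ((T.subst U).numLeaves.choose k * k.factorial) := by ring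
    _ ≤ copies D T * ((T.numLeaves : ℝ) ^ k * (U.numLeaves : ℝ) ^ k) := by gcongr
    _ = copies D T * (U.numLeaves : ℝ) ^ k * (T.numLeaves : ℝ) ^ k := by ring
    _ ≤ _ := by gcongr

theorem inducibility_nonneg (hd : 2 ≤ d) (D : DTree d) : 0 ≤ inducibility D :=
  le_trans (by positivity)
    (copies_mul_factorial_div_le_inducibility hd D (T := leaf) trivial (by simp))

/-- For every size, and not only asymptotically, the inducibility bounds the number of copies. -/
theorem copies_le_inducibility (hd : 2 ≤ d) {D T : DTree d} (hD : D.IsDary) (hT : T.IsDary) :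
    (copies D T : ℝ) ≤
      inducibility D / (D.numLeaves.factorial : ℝ) * (T.numLeaves : ℝ) ^ D.numLeaves := by
  rcases eq_or_ne T empty with rfl | hne
  · rcases eq_or_ne D empty with rfl | hD'
    · -- both sides are `1`, as for the tree with a single vertex
      have h1 := copies_mul_factorial_div_le_inducibility hd empty (T := leaf) trivial (by simp)
      have h2 : copies (empty : DTree d) leaf = 1 := by
        refine Set.ncard_eq_one.2 ⟨∅, Set.ext fun S => ⟨fun h => ?_, ?_⟩⟩
        · exact (Set.ncard_eq_zero S.toFinite).1 h.1
        · rintro rfl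
          exact ⟨by simp [numLeaves], by rw [induced_empty]; exact Iso.empty⟩
      have h3 := copies_le_choose (empty : DTree d) empty
      simp only [h2, numLeaves, Nat.choose_self] at h1 h3 ⊢
      have h4 : (copies (empty : DTree d) empty : ℝ) ≤ 1 := mod_cast h3
      simp at h1 ⊢
      linarith
    · have h := copies_le_choose D empty
      have hk := hD.numLeaves_pos hD'
      rw [numLeaves, Nat.choose_eq_zero_of_lt hk] at h
      simp [numLeaves, Nat.le_zero.1 h, hk.ne']
  · have h := copies_mul_factorial_div_le_inducibility hd D hT hne
    have hn : 0 < T.numLeaves := hT.numLeaves_pos hne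
    rw [div_le_iff₀ (by positivity)] at h
    rw [div_mul_eq_mul_div, le_div_iff₀ (by positivity)]
    exact h

/-- A bound for the number of copies that is uniform in the tree bounds the inducibility, because
`n.choose k` is asymptotically `n ^ k / k !`. -/
theorem inducibility_le (hd : 2 ≤ d) {D : DTree d} {A : ℝ}
    (h : ∀ T : DTree d, T.IsDary → (copies D T : ℝ) ≤ A * (T.numLeaves : ℝ) ^ D.numLeaves) :
    inducibility D ≤ A * (D.numLeaves.factorial : ℝ) := by
  have := neBot_comap_numLeaves hd
  set k := D.numLeaves
  have hlim : Filter.Tendsto (fun n : ℕ => A * (n : ℝ) ^ k / (n.choose k : ℝ)) Filter.atTop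
      (nhds (A * (k.factorial : ℝ))) := by
    have h1 : Filter.Tendsto (fun n : ℕ => (n.choose k : ℝ) / ((n : ℝ) ^ k / (k.factorial : ℝ)))
        Filter.atTop (nhds 1) := by
      refine (Asymptotics.isEquivalent_iff_tendsto_one ?_).1 (isEquivalent_choose k)
      filter_upwards [Filter.eventually_gt_atTop 0] with n hn
      positivity
    refine ((h1.inv₀ one_ne_zero).const_mul (A * (k.factorial : ℝ))).congr' ?_ |>.trans ?_
    · filter_upwards with n
      have := Nat.factorial_ne_zero k
      rw [inv_div]
      field_simp
    · simp
  have hlim' := hlim.comp (Filter.tendsto_comap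
    (f := fun T : {T : DTree d // T.IsDary} => T.1.numLeaves) (x := Filter.atTop))
  rw [← hlim'.limsup_eq]
  refine Filter.limsup_le_limsup (Filter.Eventually.of_forall fun T => ?_) ?_ hlim'.isBoundedUnder_le
  · exact div_le_div_of_nonneg_right (h T.1 T.2) (Nat.cast_nonneg _)
  · exact Filter.IsBoundedUnder.isCoboundedUnder_le
      ⟨0, Filter.eventually_map.2 (Filter.Eventually.of_forall fun T => density_nonneg D T.1)⟩

/-! ### The function `Z` -/

theorem sum_mul_one_sub_le {x : Fin d → ℝ} (hx : x ∈ truncatedSimplex d) {k : ℕ} (hk : 2 ≤ k) :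
    ∑ i, x i * (1 - x i) ≤ 1 - ∑ i, x i ^ k := by
  calc ∑ i, x i * (1 - x i) ≤ ∑ i, (x i - x i ^ k) := by
        refine Finset.sum_le_sum fun i _ => ?_
        have := pow_le_pow_of_le_one (hx.1 i).1 (hx.1 i).2.le hk
        nlinarith
    _ = 1 - ∑ i, x i ^ k := by rw [Finset.sum_sub_distrib, hx.2]

theorem one_sub_sum_pow_pos {x : Fin d → ℝ} (hx : x ∈ truncatedSimplex d) {k : ℕ} (hk : 2 ≤ k) :
    0 < 1 - ∑ i, x i ^ k := by
  refine lt_of_lt_of_le ?_ (sum_mul_one_sub_le hx hk)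
  obtain ⟨i, -, hi⟩ : ∃ i ∈ Finset.univ, (0 : ℝ) < x i :=
    Finset.exists_lt_of_sum_lt (by simp [hx.2])
  exact Finset.sum_pos' (fun j _ => mul_nonneg (hx.1 j).1 (sub_nonneg.2 (hx.1 j).2.le))
    ⟨i, Finset.mem_univ i, mul_pos hi (sub_pos.2 (hx.1 i).2)⟩

/-- A monomial in which at least two variables occur is small where `∑ x i ^ k` is close to `1`. -/
theorem prod_pow_le_one_sub_sum_pow {x : Fin d → ℝ} (hx : x ∈ truncatedSimplex d) {k : ℕ}
    (hk : 2 ≤ k) {m : Fin d → ℕ} {a b : Fin d} (hab : a ≠ b) (ha : 0 < m a) (hb : 0 < m b) :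
    ∏ j, x j ^ m j ≤ 1 - ∑ i, x i ^ k := by
  have h0 : ∀ j, 0 ≤ x j := fun j => (hx.1 j).1
  have h1 : ∀ j, x j ≤ 1 := fun j => (hx.1 j).2.le
  have hb' : x b ≤ 1 - x a := by
    have := Finset.add_le_sum (fun i _ => h0 i) (Finset.mem_univ a) (Finset.mem_univ b) hab
    rw [hx.2] at this
    linarith
  calc ∏ j, x j ^ m j ≤ ∏ j ∈ {a, b}, x j ^ m j := by
        rw [← Finset.prod_mul_prod_compl {a, b}]
        exact mul_le_of_le_one_right (Finset.prod_nonneg fun j _ => pow_nonneg (h0 j) _)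
          (Finset.prod_le_one (fun j _ => pow_nonneg (h0 j) _)
            fun j _ => pow_le_one₀ (h0 j) (h1 j))
    _ = x a ^ m a * x b ^ m b := Finset.prod_pair hab
    _ ≤ x a * x b := mul_le_mul (pow_le_of_le_one (h0 a) (h1 a) ha.ne')
        (pow_le_of_le_one (h0 b) (h1 b) hb.ne') (pow_nonneg (h0 b) _) (h0 a)
    _ ≤ x a * (1 - x a) := mul_le_mul_of_nonneg_left hb' (h0 a)
    _ ≤ ∑ i, x i * (1 - x i) := Finset.single_le_sum (f := fun i => x i * (1 - x i))
        (fun i _ => mul_nonneg (h0 i) (sub_nonneg.2 (h1 i))) (Finset.mem_univ a)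
    _ ≤ 1 - ∑ i, x i ^ k := sum_mul_one_sub_le hx hk

theorem Z_le_card_permReps {B : Fin d → DTree d} (hD : (node B).IsDary) {x : Fin d → ℝ}
    (hx : x ∈ truncatedSimplex d) : Z B x ≤ (permReps B).card := by
  have hk := hD.two_le_numLeaves
  obtain ⟨i, j, hij, hi, hj⟩ := hD.exists_pos_pos
  rw [Z, one_div_mul_eq_div, div_le_iff₀ (one_sub_sum_pow_pos hx hk), ← nsmul_eq_mul]
  refine Finset.sum_le_card_nsmul _ _ _ fun π _ => ?_
  exact prod_pow_le_one_sub_sum_pow hx hk (m := fun j => (B (π j)).numLeaves)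
    (π.symm.injective.ne hij) (by simpa using hi) (by simpa using hj)

theorem bddAbove_Z {B : Fin d → DTree d} (hD : (node B).IsDary) :
    BddAbove (Z B '' truncatedSimplex d) :=
  ⟨(permReps B).card, Set.forall_mem_image.2 fun _ hx => Z_le_card_permReps hD hx⟩

theorem sSup_Z_nonneg {B : Fin d → DTree d} (hD : (node B).IsDary) :
    0 ≤ sSup (Z B '' truncatedSimplex d) := by
  refine Real.sSup_nonneg (Set.forall_mem_image.2 fun x hx => ?_)
  have := one_sub_sum_pow_pos hx hD.two_le_numLeaves
  exact mul_nonneg (by positivity) (Finset.sum_nonneg fun π _ => Finset.prod_nonneg fun j _ =>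
    pow_nonneg (hx.1 j).1 _)

theorem sum_prod_pow_le {B : Fin d → DTree d} (hD : (node B).IsDary) {x : Fin d → ℝ}
    (hx : x ∈ truncatedSimplex d) :
    ∑ π ∈ permReps B, ∏ j, x j ^ (B (π j)).numLeaves ≤
      sSup (Z B '' truncatedSimplex d) * (1 - ∑ i, x i ^ (node B).numLeaves) := by
  have h := le_csSup (bddAbove_Z hD) (Set.mem_image_of_mem _ hx)
  rwa [Z, one_div_mul_eq_div, div_le_iff₀ (one_sub_sum_pow_pos hx hD.two_le_numLeaves)] at h

/-! ### The upper bound -/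

/-- The proportions of the leaves of a tree that lie in its branches. -/
theorem proportions_mem_truncatedSimplex {T : Fin d → DTree d} (hT : (node T).IsDary) :
    (fun i => ((T i).numLeaves : ℝ) / (node T).numLeaves) ∈ truncatedSimplex d := by
  have hn : 0 < (node T).numLeaves := by
    have := hT.two_le_numLeaves
    omega
  have hn' : (0 : ℝ) < (node T).numLeaves := mod_cast hn
  obtain ⟨a, b, hab, ha, hb⟩ := hT.exists_pos_pos
  refine ⟨fun i => ⟨by positivity, ?_⟩, ?_⟩
  · rw [div_lt_one hn', Nat.cast_lt]
    obtain ⟨j, hji, hj⟩ : ∃ j, j ≠ i ∧ 0 < (T j).numLeaves := by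
      by_cases h : a = i
      · exact ⟨b, fun hb => hab (h.trans hb.symm), hb⟩
      · exact ⟨a, h, ha⟩
    have := Finset.add_le_sum (f := fun i => (T i).numLeaves) (fun _ _ => Nat.zero_le _)
      (Finset.mem_univ i) (Finset.mem_univ j) hji.symm
    simp only [numLeaves]
    omega
  · rw [← Finset.sum_div, div_eq_one_iff_eq hn'.ne', numLeaves, Nat.cast_sum]

/-- Since the exponents add up to `‖D‖`, the bound for `Z` becomes homogeneous. -/
theorem sum_prod_numLeaves_pow_le {B T : Fin d → DTree d} (hD : (node B).IsDary)
    (hT : (node T).IsDary) :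
    ∑ π ∈ permReps B, ∏ j, ((T j).numLeaves : ℝ) ^ (B (π j)).numLeaves ≤
      sSup (Z B '' truncatedSimplex d) * (((node T).numLeaves : ℝ) ^ (node B).numLeaves -
        ∑ i, ((T i).numLeaves : ℝ) ^ (node B).numLeaves) := by
  have hn : (0 : ℝ) < (node T).numLeaves := by
    have := hT.two_le_numLeaves
    exact mod_cast (by omega : 0 < (node T).numLeaves)
  have h := sum_prod_pow_le hD (proportions_mem_truncatedSimplex hT)
  have hprod : ∀ π : Equiv.Perm (Fin d),
      ∏ j, (((T j).numLeaves : ℝ) / (node T).numLeaves) ^ (B (π j)).numLeaves =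
        (∏ j, ((T j).numLeaves : ℝ) ^ (B (π j)).numLeaves) /
          ((node T).numLeaves : ℝ) ^ (node B).numLeaves := by
    intro π
    simp only [div_pow]
    rw [Finset.prod_div_distrib, Finset.prod_pow_eq_pow_sum,
      Equiv.sum_comp π fun i => (B i).numLeaves, show ∑ i, (B i).numLeaves = (node B).numLeaves from rfl]
  simp only [hprod] at h
  simp only [div_pow, ← Finset.sum_div] at h
  rw [div_le_iff₀ (by positivity)] at h
  refine h.trans_eq ?_
  field_simp

theorem copies_node_le_pow (hd : 2 ≤ d) {B : Fin d → DTree d} (hD : (node B).IsDary)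
    {T : DTree d} (hT : T.IsDary) :
    (copies (node B) T : ℝ) ≤
      (∏ i, (B i).inducibility / ((B i).numLeaves.factorial : ℝ)) *
        sSup (Z B '' truncatedSimplex d) * (T.numLeaves : ℝ) ^ (node B).numLeaves := by
  have hk := hD.two_le_numLeaves
  set P := ∏ i, (B i).inducibility / ((B i).numLeaves.factorial : ℝ)
  set s := sSup (Z B '' truncatedSimplex d)
  have hP : 0 ≤ P := Finset.prod_nonneg fun i _ =>
    div_nonneg (inducibility_nonneg hd _) (Nat.cast_nonneg _)
  have hs : 0 ≤ s := sSup_Z_nonneg hD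
  have hsmall : ∀ T : DTree d, T.numLeaves < (node B).numLeaves →
      (copies (node B) T : ℝ) ≤ P * s * (T.numLeaves : ℝ) ^ (node B).numLeaves := by
    intro T hT
    have h := copies_le_choose (node B) T
    rw [Nat.choose_eq_zero_of_lt hT] at h
    rw [Nat.le_zero.1 h, Nat.cast_zero]
    positivity
  induction T with
  | empty => exact hsmall _ (by simp only [numLeaves] at hk ⊢; omega)
  | leaf => exact hsmall _ (by simp only [numLeaves] at hk ⊢; omega)
  | node T ih =>
    have hprod : ∀ π : Equiv.Perm (Fin d), ∏ j, (copies (B (π j)) (T j) : ℝ) ≤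
        P * ∏ j, ((T j).numLeaves : ℝ) ^ (B (π j)).numLeaves := by
      intro π
      rw [show P = ∏ j, (B (π j)).inducibility / ((B (π j)).numLeaves.factorial : ℝ) from
        (Equiv.prod_comp π fun i => (B i).inducibility / ((B i).numLeaves.factorial : ℝ)).symm,
        ← Finset.prod_mul_distrib]
      exact Finset.prod_le_prod (fun _ _ => Nat.cast_nonneg _) fun j _ =>
        copies_le_inducibility hd (hD.2 _) (hT.2 j)
    calc (copies (node B) (node T) : ℝ)
        ≤ ∑ i, (copies (node B) (T i) : ℝ) +
          ∑ π ∈ permReps B, ∏ j, (copies (B (π j)) (T j) : ℝ) := mod_cast copies_node_le B T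
      _ ≤ ∑ i, P * s * ((T i).numLeaves : ℝ) ^ (node B).numLeaves +
          ∑ π ∈ permReps B, P * ∏ j, ((T j).numLeaves : ℝ) ^ (B (π j)).numLeaves :=
        add_le_add (Finset.sum_le_sum fun i _ => ih i (hT.2 i))
          (Finset.sum_le_sum fun π _ => hprod π)
      _ ≤ P * s * ∑ i, ((T i).numLeaves : ℝ) ^ (node B).numLeaves +
          P * (s * (((node T).numLeaves : ℝ) ^ (node B).numLeaves -
            ∑ i, ((T i).numLeaves : ℝ) ^ (node B).numLeaves)) := by
        rw [← Finset.mul_sum, ← Finset.mul_sum]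
        gcongr
        exact sum_prod_numLeaves_pow_le hD hT
      _ = P * s * ((node T).numLeaves : ℝ) ^ (node B).numLeaves := by ring

end DTree

theorem proposition3 (d : ℕ) (hd : 2 ≤ d) (B : Fin d → DTree d)
    (hD : (DTree.node B).IsDary) :
    BddAbove (DTree.Z B '' truncatedSimplex d) ∧
    (DTree.node B).inducibility ≤
      (Nat.multinomial Finset.univ (fun i => (B i).numLeaves) : ℝ) *
        (∏ i, (B i).inducibility) *
        sSup (DTree.Z B '' truncatedSimplex d) := by
  refine ⟨DTree.bddAbove_Z hD, (DTree.inducibility_le hd fun T hT =>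
    DTree.copies_node_le_pow hd hD hT).trans_eq ?_⟩
  have hmult : (∏ i, ((B i).numLeaves.factorial : ℝ)) *
      Nat.multinomial Finset.univ (fun i => (B i).numLeaves) =
        (DTree.node B).numLeaves.factorial := by
    rw [DTree.numLeaves]
    exact mod_cast Nat.multinomial_spec Finset.univ fun i => (B i).numLeaves
  have hne : ∏ i, ((B i).numLeaves.factorial : ℝ) ≠ 0 :=
    Finset.prod_ne_zero_iff.2 fun i _ => mod_cast Nat.factorial_ne_zero _
  rw [← hmult, Finset.prod_div_distrib]
  field_simp
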